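/- Let $b \ge 2$ be a fixed base and $A_b=\{0,1,\dots,b-1\}$. A complete deterministic automaton $\mathcal B=(Q',A_b,\eta,j,S)$ is a \emph{quotient} of a complete deterministic automaton $\mathcal A=(Q,A_b,\delta,i,T)$ if there is a surjective map $\varphi\colon Q\to Q'$ with $\varphi(i)=j$, $\varphi(\delta(q,a))=\eta(\varphi(q),a)$ for all $q\in Q$, $a\in A_b$, and $q\in T\iff\varphi(q)\in S$ for all $q \in Q$. For $p\ge 1$ coprime to $b$ and $R\subseteq\{0,\dots,p-1\}$ such that $p$ is the smallest period of the periodic set $\{n\in\mathbb N : n \bmod p\in R\}$, the \emph{Pascal automaton} $\mathcal P_{R,p}$ has the state set $\mathbb Z/p\mathbb Z\times\mathbb Z/\psi\mathbb Z$, where $\psi$ is the multiplicative order of $b$ modulo $p$, the initial state $(0,0)$, the final states $R\times\mathbb Z/\psi\mathbb Z$, and the transitions $(s,t)\cdot a=(s+a\,b^{t},\,t+1)$ for $a\in A_b$. A complete DFA is \emph{minimal} if all its states are accessible and distinct states have distinct future languages. Theorem. It is decidable in linear time whether a minimal complete DFA $\mathcal A$ over $A_b$ is a quotient of a Pascal automaton.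 Precisely: for every $b\ge 2$ there are a program of a unit-cost random access machine (with the arithmetic operations addition and truncated subtraction, comparison, and indirect loads and stores) and a constant $C$ such that, for every $n$ and every minimal complete DFA $\mathcal A$ over $A_b$ with state set $\{0,\dots,n-1\}$, given by $n$, its initial state, its transition table and its list of final flags, the program halts after at most $C\,n$ steps, using throughout only numbers and addresses at most $C\,n$ (words of $\log_2 n+O(1)$ bits), with output $1$ if there are $R,p$ such that $\mathcal A$ is a quotient of the Pascal automaton $\mathcal P_{R,p}$, and with output $0$ otherwise. -/

import Mathlib

/-! ### Complete deterministic automata: coverings, quotients, minimality -/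

/-- `φ` is a covering from the complete automaton `A` onto the complete automaton `B`: it maps the
initial state to the initial state, commutes with the transitions, and the final states of `A` are
exactly the states lying over the final states of `B`. -/
structure IsCovering {α σ τ : Type*} (A : DFA α σ) (B : DFA α τ) (φ : σ → τ) : Prop where
  surjective : Function.Surjective φ
  map_start : φ A.start = B.start
  map_step : ∀ q a, φ (A.step q a) = B.step (φ q) a
  mem_accept_iff : ∀ q, q ∈ A.accept ↔ φ q ∈ B.accept

/-- `B` is a quotient of `A`. -/
def IsQuotientOf {α σ τ : Type*} (B : DFA α τ) (A : DFA α σ) : Prop :=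
  ∃ φ : σ → τ, IsCovering A B φ

/-- A complete DFA is minimal if every state is accessible from the initial state and distinct
states have distinct future languages. -/
structure IsMinimalDFA {α σ : Type*} (A : DFA α σ) : Prop where
  accessible : ∀ q, ∃ w : List α, A.eval w = q
  reduced : ∀ q q', A.acceptsFrom q = A.acceptsFrom q' → q = q'

/-! ### Periodic sets of numbers and Pascal automata -/

/-- The set of all natural numbers congruent modulo `q` to an element of `S`. -/
def periodicSet (S : Set ℕ) (q : ℕ) : Set ℕ :=
  {n | ∃ r ∈ S, n ≡ r [MOD q]}

/-- `E` is periodic of (positive) period `q`. -/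
def IsPeriodOf (E : Set ℕ) (q : ℕ) : Prop :=
  0 < q ∧ ∃ S : Set ℕ, (∀ r ∈ S, r < q) ∧ E = periodicSet S q

/-- `p` is the smallest period, and `R` the set of residues, of a periodic set of numbers. -/
def IsCanonicalPair (R : Set ℕ) (p : ℕ) : Prop :=
  (∀ r ∈ R, r < p) ∧ IsLeast {q | IsPeriodOf (periodicSet R p) q} p

/-- The automaton with state set `ℤ/pℤ × ℤ/ψℤ`, where `ψ` is the order of `b` modulo `p`. It reads
base `b` numerals, least significant digit first: after a word `u` its state is
`(value of u mod p, length of u mod ψ)`. -/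
noncomputable def pascalAutomaton (b p : ℕ) (R : Set ℕ) :
    DFA (Fin b) (ZMod p × ZMod (orderOf (b : ZMod p))) where
  step q a := (q.1 + ((a : ℕ) : ZMod p) * (b : ZMod p) ^ q.2.val, q.2 + 1)
  start := (0, 0)
  accept := {q | ∃ r ∈ R, (r : ZMod p) = q.1}

/-- `A` is a quotient of a Pascal automaton in base `b`, with period coprime to `b` and canonical
parameters. -/
def IsPascalQuotient {b : ℕ} {σ : Type*} (A : DFA (Fin b) σ) : Prop :=
  ∃ (p : ℕ) (R : Set ℕ), p.Coprime b ∧ IsCanonicalPair R p ∧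
    IsQuotientOf A (pascalAutomaton b p R)

/-! ### Random access machines with bounded words and unit cost -/

/-- The store of a random access machine: registers, and a memory addressed by numbers. A program
mentions only finitely many registers. -/
structure Store where
  reg : ℕ → ℕ
  mem : ℕ → ℕ

/-- `σ.setReg x v` is `σ` with `v` written into register `x`. -/
def Store.setReg (σ : Store) (x v : ℕ) : Store :=
  { σ with reg := Function.update σ.reg x v }

/-- `σ.setMem i v` is `σ` with `v` written into the memory cell with address `i`. -/
def Store.setMem (σ : Store) (i v : ℕ) : Store :=
  { σ with mem := Function.update σ.mem i v }

/-- Programs of a random access machine, with structured control. The arguments `x y z` are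
names of registers. -/
inductive Program where
  /-- do nothing -/
  | skip : Program
  /-- `x := c` -/
  | const (x c : ℕ) : Program
  /-- `x := y` -/
  | copy (x y : ℕ) : Program
  /-- `x := y + z` -/
  | add (x y z : ℕ) : Program
  /-- `x := y - z`, truncated at `0` -/
  | sub (x y z : ℕ) : Program
  /-- `x := mem[y]` -/
  | load (x y : ℕ) : Program
  /-- `mem[x] := y` -/
  | store (x y : ℕ) : Program
  /-- first `P`, then `Q` -/
  | seq (P Q : Program) : Program
  /-- if `x < y` then `P` else `Q` -/
  | ifLt (x y : ℕ) (P Q : Program) : Program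
  /-- while `x < y` do `P` -/
  | whileLt (x y : ℕ) (P : Program) : Program

/-- `Exec W P σ t σ'`: on a machine whose words hold the numbers `0, …, W`, the program `P`, started
in the store `σ`, halts in the store `σ'` after exactly `t` steps. Each elementary instruction and
each evaluation of a test is one step. There is no execution in which a constant or a sum exceeds
`W`, so in a run from a store with entries at most `W` all numbers and all addresses that are used
stay at most `W`. -/
inductive Exec (W : ℕ) : Program → Store → ℕ → Store → Prop
  | skip (σ : Store) : Exec W .skip σ 1 σ
  | const (σ : Store) (x c : ℕ) (h : c ≤ W) : Exec W (.const x c) σ 1 (σ.setReg x c)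
  | copy (σ : Store) (x y : ℕ) : Exec W (.copy x y) σ 1 (σ.setReg x (σ.reg y))
  | add (σ : Store) (x y z : ℕ) (h : σ.reg y + σ.reg z ≤ W) :
      Exec W (.add x y z) σ 1 (σ.setReg x (σ.reg y + σ.reg z))
  | sub (σ : Store) (x y z : ℕ) : Exec W (.sub x y z) σ 1 (σ.setReg x (σ.reg y - σ.reg z))
  | load (σ : Store) (x y : ℕ) : Exec W (.load x y) σ 1 (σ.setReg x (σ.mem (σ.reg y)))
  | store (σ : Store) (x y : ℕ) : Exec W (.store x y) σ 1 (σ.setMem (σ.reg x) (σ.reg y))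
  | seq {P Q : Program} {σ₀ σ₁ σ₂ : Store} {t₁ t₂ : ℕ}
      (h₁ : Exec W P σ₀ t₁ σ₁) (h₂ : Exec W Q σ₁ t₂ σ₂) : Exec W (.seq P Q) σ₀ (t₁ + t₂) σ₂
  | ifLt_true {x y : ℕ} {P Q : Program} {σ σ' : Store} {t : ℕ}
      (h : σ.reg x < σ.reg y) (h₁ : Exec W P σ t σ') : Exec W (.ifLt x y P Q) σ (t + 1) σ'
  | ifLt_false {x y : ℕ} {P Q : Program} {σ σ' : Store} {t : ℕ}
      (h : ¬ σ.reg x < σ.reg y) (h₁ : Exec W Q σ t σ') : Exec W (.ifLt x y P Q) σ (t + 1) σ'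
  | while_true {x y : ℕ} {P : Program} {σ₀ σ₁ σ₂ : Store} {t₁ t₂ : ℕ}
      (h : σ₀.reg x < σ₀.reg y) (h₁ : Exec W P σ₀ t₁ σ₁)
      (h₂ : Exec W (.whileLt x y P) σ₁ t₂ σ₂) : Exec W (.whileLt x y P) σ₀ (t₁ + t₂ + 1) σ₂
  | while_false {x y : ℕ} {P : Program} {σ : Store}
      (h : ¬ σ.reg x < σ.reg y) : Exec W (.whileLt x y P) σ 1 σ

/-! ### Automata as inputs -/

open Classical in
/-- The description of an automaton with states `0, …, n-1` over the digits `0, …, b-1`: the number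
of states, the initial state, the transition table row by row, and for each state the flag
`1` (final) or `0` (not final). -/
noncomputable def encodeDFA {b n : ℕ} (A : DFA (Fin b) (Fin n)) : List ℕ :=
  [n, (A.start : ℕ)] ++
    (List.finRange n).flatMap (fun q => (List.finRange b).map fun a => (A.step q a : ℕ)) ++
    (List.finRange n).map (fun q => if q ∈ A.accept then 1 else 0)

/-- The initial store on input `A`: the description of `A` fills the memory from address `0` on, and
all the rest is `0`. -/
noncomputable def inputStore {b n : ℕ} (A : DFA (Fin b) (Fin n)) : Store where
  reg _ := 0
  mem i := (encodeDFA A).getD i 0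

/-! Being a quotient of a Pascal automaton is a local property. In a Pascal automaton every digit
permutes the states. The digit `1` followed by the inverse of the digit `0` is the translation `(s,
t) ↦ (s + b ^ t, t)`, and this descends to every quotient as a map `G`. Three relations hold at
every state: `q·(a+1) = G(q)·a`, `G(q·0) = G(q)·(b-1)`, and `q·0` is final iff `q` is.

Conversely, these relations suffice (`LocallyPascal.isPascalQuotient`). They give `q·a = (G^a q)·0`
and `G(q·0) = (G^b q)·0`, so a word of length `l` and value `v` leads from the initial state `i` to
`(G^v i)·0^l` (`LocallyPascal.evalFrom_eq`). This state is final iff `v` lies in `E = {v | G^v i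
final}`. The permutation `G` is conjugate to `G^b`, so its order is coprime to `b`, and so is the
smallest period `p` of `E`. By minimality the state depends only on `v` mod `p` and `b ^ l` mod `p`,
which yields the covering.

The algorithm therefore never computes `p` or `R`. One pass over the states tabulates inverses of
the digits `0` and `1`; a second pass checks a fixed number of equations per state. The table may be
wrong when a digit is not injective, but the first two equations detect this
(`forall_pascalEquations_iff`). -/

/-! ### Purely periodic sets and the shift -/

/-- The shift of a set of numbers. -/
def setShift (E : Set ℕ) : Set ℕ := {v | v + 1 ∈ E}

theorem mem_iterate_setShift (E : Set ℕ) (q v : ℕ) : v ∈ setShift^[q] E ↔ v + q ∈ E := by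
  induction q generalizing E with
  | zero => simp
  | succ q ih =>
    rw [Function.iterate_succ_apply, ih]
    simp [setShift, add_assoc]

/-- With periods read as periods of `E` under the shift, `Function.minimalPeriod` supplies the
smallest period and the fact that it divides all others. -/
theorem isPeriodicPt_setShift_iff {E : Set ℕ} {q : ℕ} :
    Function.IsPeriodicPt setShift q E ↔ ∀ v, v + q ∈ E ↔ v ∈ E := by
  rw [Function.IsPeriodicPt, Function.IsFixedPt, Set.ext_iff]
  simp only [mem_iterate_setShift]

theorem mem_iff_of_modEq {E : Set ℕ} {q u v : ℕ} (h : ∀ v, v + q ∈ E ↔ v ∈ E)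
    (huv : u ≡ v [MOD q]) : u ∈ E ↔ v ∈ E := by
  have key : ∀ m v, v + q * m ∈ E ↔ v ∈ E := by
    intro m
    induction m with
    | zero => simp
    | succ m ih => intro v; rw [mul_add, mul_one, ← add_assoc, h, ih]
  have e : ∀ w, w ∈ E ↔ w % q ∈ E := fun w => by
    conv_lhs => rw [← Nat.mod_add_div w q, key]
  rw [e u, e v, huv]

theorem periodicSet_residues {E : Set ℕ} {q : ℕ} (hq : 0 < q) (h : ∀ v, v + q ∈ E ↔ v ∈ E) :
    periodicSet {r | r ∈ E ∧ r < q} q = E := by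
  ext v
  constructor
  · rintro ⟨r, ⟨hr, -⟩, hv⟩
    exact (mem_iff_of_modEq h hv).2 hr
  · intro hv
    exact ⟨v % q, ⟨(mem_iff_of_modEq h (Nat.mod_modEq v q)).2 hv, Nat.mod_lt _ hq⟩,
      (Nat.mod_modEq v q).symm⟩

theorem isPeriodOf_iff {E : Set ℕ} {q : ℕ} :
    IsPeriodOf E q ↔ 0 < q ∧ ∀ v, v + q ∈ E ↔ v ∈ E := by
  constructor
  · rintro ⟨hq, S, -, rfl⟩
    refine ⟨hq, fun v => ?_⟩
    simp [periodicSet, Nat.ModEq]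
  · rintro ⟨hq, h⟩
    exact ⟨hq, _, fun r hr => hr.2, (periodicSet_residues hq h).symm⟩

/-! ### A local characterisation of the quotients of Pascal automata -/

section LocalCharacterisation

variable {b : ℕ} {α : Type*}

/-- The digits `0` and `1` act injectively, `G` is the action of the digit `1` followed by the
inverse of the action of `0`, and the relations of a Pascal automaton hold at every state. -/
structure LocallyPascal (hb : 2 ≤ b) (A : DFA (Fin b) α) (G : α → α) : Prop where
  injective_zero : Function.Injective fun q => A.step q ⟨0, by omega⟩
  injective_one : Function.Injective fun q => A.step q ⟨1, by omega⟩
  step_succ : ∀ q (a : ℕ) (ha : a + 1 < b), A.step q ⟨a + 1, ha⟩ = A.step (G q) ⟨a, by omega⟩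
  step_zero : ∀ q, G (A.step q ⟨0, by omega⟩) = A.step (G q) ⟨b - 1, by omega⟩
  accept_iff : ∀ q, A.step q ⟨0, by omega⟩ ∈ A.accept ↔ q ∈ A.accept

/-- The wrap-around of the exponent modulo `ψ` is harmless because `b ^ ψ = 1` modulo `p`. -/
theorem pascal_pow_val_add_one {p : ℕ} [NeZero (orderOf (b : ZMod p))]
    (t : ZMod (orderOf (b : ZMod p))) :
    (b : ZMod p) ^ (t + 1).val = (b : ZMod p) ^ t.val * b := by
  rw [← pow_succ, ZMod.val_add, pow_mod_orderOf, ← pow_mod_orderOf _ (t.val + 1),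
    ← pow_mod_orderOf _ (t.val + _), ZMod.val_one_eq_one_mod, Nat.add_mod_mod]

/-- Coprimality makes `b` a unit of a finite ring. Positivity matters because `ZMod 0` would be `ℤ`,
an infinite second component. -/
theorem orderOf_natCast_pos {p : ℕ} (hp : 0 < p) (h : p.Coprime b) :
    0 < orderOf (b : ZMod p) := by
  have : NeZero p := ⟨hp.ne'⟩
  have := orderOf_pos (ZMod.unitOfCoprime b h.symm)
  rwa [← orderOf_units, ZMod.coe_unitOfCoprime] at this

/-- Each relation is an identity in `ℤ/p × ℤ/ψ` pushed forward along the covering. The condition on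
`G` is required only when the digit `0` is injective, since the `G` read off the computed table is
reliable only then. -/
theorem IsPascalQuotient.locallyPascal [Finite α] (hb : 2 ≤ b) {A : DFA (Fin b) α}
    (hA : IsPascalQuotient A) {G : α → α}
    (hG : Function.Injective (fun q => A.step q ⟨0, by omega⟩) →
      ∀ q, A.step (G q) ⟨0, by omega⟩ = A.step q ⟨1, by omega⟩) :
    LocallyPascal hb A G := by
  obtain ⟨p, R, hpb, ⟨-, hleast⟩, φ, hφ⟩ := hA
  have hp : 0 < p := hleast.1.1
  have : NeZero (orderOf (b : ZMod p)) := ⟨(orderOf_natCast_pos hp hpb).ne'⟩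
  have hstep : ∀ s t (a : ℕ) (ha : a < b), A.step (φ (s, t)) ⟨a, ha⟩ =
      φ (s + (a : ZMod p) * (b : ZMod p) ^ t.val, t + 1) := fun s t a ha =>
    (hφ.map_step (s, t) ⟨a, ha⟩).symm
  have hinj : ∀ (a : ℕ) (ha : a < b), Function.Injective fun q => A.step q ⟨a, ha⟩ := by
    intro a ha
    -- On a finite set surjectivity suffices, and it passes to quotients: a predecessor of `(s, t)`
    -- under `a` is `(s - a * b ^ (t - 1), t - 1)`.
    refine Finite.injective_iff_surjective.2 fun q => ?_
    obtain ⟨⟨s, t⟩, rfl⟩ := hφ.surjective q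
    refine ⟨φ (s - (a : ZMod p) * (b : ZMod p) ^ (t - 1).val, t - 1), ?_⟩
    simp [hstep]
  -- Both sides have the same successor under the injective digit `0`.
  have hφG : ∀ s t, G (φ (s, t)) = φ (s + (b : ZMod p) ^ t.val, t) := by
    intro s t
    apply hinj 0 (by omega)
    change A.step _ _ = A.step _ _
    rw [hG (hinj 0 _), hstep, hstep]
    simp
  refine ⟨hinj 0 _, hinj 1 _, fun q a ha => ?_, fun q => ?_, fun q => ?_⟩ <;>
    obtain ⟨⟨s, t⟩, rfl⟩ := hφ.surjective q
  · rw [hφG, hstep, hstep]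
    congr 2
    push_cast
    ring
  · rw [hφG, hstep, hstep, hφG, pascal_pow_val_add_one, Nat.cast_sub (by omega)]
    congr 2
    push_cast
    ring
  · rw [hstep, ← hφ.mem_accept_iff, ← hφ.mem_accept_iff]
    simp [pascalAutomaton]

/-! ### From the local relations back to a Pascal automaton -/

namespace LocallyPascal

variable {hb : 2 ≤ b} {A : DFA (Fin b) α} {G : α → α}

/-- The value of a numeral, least significant digit first. -/
def lsdValue (w : List (Fin b)) : ℕ := Nat.ofDigits b (w.map Fin.val)

theorem step_eq (h : LocallyPascal hb A G) (a : ℕ) (ha : a < b) (q : α) :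
    A.step q ⟨a, ha⟩ = A.step (G^[a] q) ⟨0, by omega⟩ := by
  induction a generalizing q with
  | zero => rfl
  | succ a ih => rw [h.step_succ, ih, Function.iterate_succ_apply]

/-- The Baumslag–Solitar relation between `G` and the digit `0`: the digit `b - 1` contributes `b -
1` applications of `G`, one more comes from `G q`. -/
theorem map_step_zero (h : LocallyPascal hb A G) (q : α) :
    G (A.step q ⟨0, by omega⟩) = A.step (G^[b] q) ⟨0, by omega⟩ := by
  rw [h.step_zero, h.step_eq, ← Function.iterate_succ_apply, Nat.succ_eq_add_one,
    Nat.sub_add_cancel (by omega)]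

theorem iterate_step_zero (h : LocallyPascal hb A G) (m t : ℕ) (q : α) :
    G^[m] ((fun q => A.step q ⟨0, by omega⟩)^[t] q) =
      (fun q => A.step q ⟨0, by omega⟩)^[t] (G^[m * b ^ t] q) := by
  have one : ∀ m q, G^[m] (A.step q ⟨0, by omega⟩) = A.step (G^[m * b] q) ⟨0, by omega⟩ := by
    intro m
    induction m with
    | zero => simp
    | succ m ih =>
      intro q
      rw [Function.iterate_succ_apply, h.map_step_zero, ih, ← Function.iterate_add_apply]
      ring_nf
  induction t generalizing m with
  | zero => simp
  | succ t ih =>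
    rw [Function.iterate_succ_apply', Function.iterate_succ_apply', one, ih]
    ring_nf

/-- Normal form for reachable states: moving `G` past `t` zeros turns a digit `a` into `a * b ^ t`
applications of `G`, so a word acts only through its value and its length. -/
theorem evalFrom_eq (h : LocallyPascal hb A G) (w : List (Fin b)) (v t : ℕ) (q : α) :
    A.evalFrom ((fun q => A.step q ⟨0, by omega⟩)^[t] (G^[v] q)) w =
      (fun q => A.step q ⟨0, by omega⟩)^[t + w.length] (G^[v + b ^ t * lsdValue w] q) := by
  induction w generalizing v t with
  | nil => simp [lsdValue]
  | cons a w ih =>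
    rw [DFA.evalFrom_cons, h.step_eq a.1 a.2, h.iterate_step_zero, ← Function.iterate_add_apply,
      ← Function.iterate_succ_apply' (fun q => A.step q ⟨0, _⟩), ih]
    simp only [lsdValue, List.map_cons, Nat.ofDigits_cons, List.length_cons]
    rw [Nat.succ_eq_add_one, add_right_comm t 1, add_assoc t]
    congr 2
    ring

theorem iterate_step_zero_mem_accept (h : LocallyPascal hb A G) (t : ℕ) (q : α) :
    (fun q => A.step q ⟨0, by omega⟩)^[t] q ∈ A.accept ↔ q ∈ A.accept := by
  induction t with
  | zero => rfl
  | succ t ih => rw [Function.iterate_succ_apply', h.accept_iff, ih]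

theorem injective (h : LocallyPascal hb A G) : Function.Injective G := fun x y hxy =>
  h.injective_one <| by simp only [h.step_eq 1, Function.iterate_one, hxy]

/-- The digit `0` conjugates `G ^ b` to `G`, so both have the same order; a power `g ^ b` keeps the
order of `g` only if that order is coprime to `b`. -/
theorem exists_coprime_iterate_eq [Finite α] (h : LocallyPascal hb A G) :
    ∃ N, 0 < N ∧ N.Coprime b ∧ G^[N] = id := by
  let g : Equiv.Perm α := Equiv.ofBijective G (Finite.injective_iff_bijective.1 h.injective)
  let d : Equiv.Perm α := Equiv.ofBijective _ (Finite.injective_iff_bijective.1 h.injective_zero)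
  have hpow : ∀ m, ⇑(g ^ m) = G^[m] := fun m => by rw [Equiv.Perm.coe_pow]; rfl
  have hconj : g * d = d * g ^ b := by
    ext q
    simp only [Equiv.Perm.mul_apply, hpow]
    exact h.map_step_zero q
  have hord : orderOf (g ^ b) = orderOf g := by
    have : g = d * g ^ b * d⁻¹ := by rw [← hconj]; group
    conv_rhs => rw [this, ← MulAut.conj_apply, MulEquiv.orderOf_eq]
  have hpos : 0 < orderOf g := orderOf_pos g
  refine ⟨orderOf g, hpos, ?_, ?_⟩
  · rw [orderOf_pow] at hord
    exact (Nat.div_eq_self.1 hord).resolve_left hpos.ne'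
  · rw [← hpow, pow_orderOf_eq_one]; rfl

theorem isPascalQuotient [Finite α] (h : LocallyPascal hb A G) (hA : IsMinimalDFA A) :
    IsPascalQuotient A := by
  obtain ⟨N, hN, hNb, hGN⟩ := h.exists_coprime_iterate_eq
  set E : Set ℕ := {v | G^[v] A.start ∈ A.accept} with hE
  have hper : Function.IsPeriodicPt setShift N E := by
    refine isPeriodicPt_setShift_iff.2 fun v => ?_
    simp [hE, Function.iterate_add_apply, hGN]
  set p := Function.minimalPeriod setShift E with hp_def
  have hp : 0 < p := hper.minimalPeriod_pos hN
  have hpE : ∀ v, v + p ∈ E ↔ v ∈ E :=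
    isPeriodicPt_setShift_iff.1 (Function.isPeriodicPt_minimalPeriod _ _)
  have hpb : p.Coprime b := Nat.Coprime.coprime_dvd_left hper.minimalPeriod_dvd hNb
  set st : ℕ → ℕ → α := fun v t =>
    (fun q => A.step q ⟨0, by omega⟩)^[t] (G^[v] A.start) with hst
  have hst_accept : ∀ v t, st v t ∈ A.accept ↔ v ∈ E := fun v t =>
    h.iterate_step_zero_mem_accept t _
  have hst_eval : ∀ v t w, A.evalFrom (st v t) w = st (v + b ^ t * lsdValue w) (t + w.length) :=
    fun v t w => h.evalFrom_eq w v t _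
  -- Here minimality enters: the future of `st v t` under `w` depends only on `v + b ^ t * lsdValue
  -- w` modulo the period `p` of `E`.
  have hst_congr : ∀ v v' t t' : ℕ, (v : ZMod p) = v' → (b : ZMod p) ^ t = (b : ZMod p) ^ t' →
      st v t = st v' t' := by
    intro v v' t t' hv ht
    apply hA.reduced
    ext w
    rw [DFA.mem_acceptsFrom, DFA.mem_acceptsFrom, hst_eval, hst_eval, hst_accept, hst_accept]
    apply mem_iff_of_modEq hpE
    rw [← ZMod.natCast_eq_natCast_iff]
    push_cast
    rw [hv, ht]
  have hNe : NeZero p := ⟨hp.ne'⟩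
  have hNe' : NeZero (orderOf (b : ZMod p)) := ⟨(orderOf_natCast_pos hp hpb).ne'⟩
  refine ⟨p, {r | r ∈ E ∧ r < p}, hpb, ⟨fun r hr => hr.2, ?_⟩,
    fun x => st x.1.val x.2.val, ?_, ?_, ?_, ?_⟩
  · rw [periodicSet_residues hp hpE]
    refine ⟨isPeriodOf_iff.2 ⟨hp, hpE⟩, fun q hq => ?_⟩
    obtain ⟨hq, hqE⟩ := isPeriodOf_iff.1 hq
    exact (isPeriodicPt_setShift_iff.2 hqE).minimalPeriod_le hq
  · intro q
    obtain ⟨w, rfl⟩ := hA.accessible q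
    refine ⟨((lsdValue w : ZMod p), (w.length : ZMod _)), ?_⟩
    have := hst_eval 0 0 w
    simp only [hst, Function.iterate_zero, id, pow_zero, one_mul, zero_add] at this
    rw [DFA.eval, this]
    apply hst_congr
    · simp
    · rw [ZMod.val_natCast, pow_mod_orderOf]
  · simp [pascalAutomaton, hst]
  · rintro ⟨s, t⟩ a
    have := hst_eval s.val t.val [a]
    rw [DFA.evalFrom_cons, DFA.evalFrom_nil] at this
    rw [this]
    apply hst_congr
    · simp [pascalAutomaton, lsdValue, mul_comm]
    · change (b : ZMod p) ^ (t + 1).val = _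
      rw [pascal_pow_val_add_one, ← pow_succ]; rfl
  · rintro ⟨s, t⟩
    rw [hst_accept]
    constructor
    · rintro ⟨r, ⟨hr, hrp⟩, rfl⟩
      simpa [ZMod.val_natCast, Nat.mod_eq_of_lt hrp] using hr
    · intro hs
      exact ⟨s.val, ⟨hs, ZMod.val_lt s⟩, by simp⟩

end LocallyPascal

end LocalCharacterisation

/-! ### Running programs -/

/-- From the store `σ` the program `P` reaches the store `σ'` in at most `T` steps. -/
def Reaches (W : ℕ) (P : Program) (σ : Store) (T : ℕ) (σ' : Store) : Prop :=
  ∃ t ≤ T, Exec W P σ t σ'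

namespace Reaches

variable {W : ℕ} {P Q : Program} {σ σ₁ σ₂ : Store} {T T₁ T₂ : ℕ}

theorem mono (h : Reaches W P σ T₁ σ₁) (hT : T₁ ≤ T₂) : Reaches W P σ T₂ σ₁ :=
  let ⟨t, ht, h⟩ := h
  ⟨t, ht.trans hT, h⟩

theorem seq (h₁ : Reaches W P σ T₁ σ₁) (h₂ : Reaches W Q σ₁ T₂ σ₂) :
    Reaches W (.seq P Q) σ (T₁ + T₂) σ₂ :=
  let ⟨t₁, ht₁, h₁⟩ := h₁
  let ⟨t₂, ht₂, h₂⟩ := h₂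
  ⟨t₁ + t₂, by omega, .seq h₁ h₂⟩

theorem skip : Reaches W .skip σ 1 σ := ⟨1, le_rfl, .skip σ⟩

theorem const {x c : ℕ} (h : c ≤ W) : Reaches W (.const x c) σ 1 (σ.setReg x c) :=
  ⟨1, le_rfl, .const σ x c h⟩

theorem copy {x y : ℕ} : Reaches W (.copy x y) σ 1 (σ.setReg x (σ.reg y)) :=
  ⟨1, le_rfl, .copy σ x y⟩

theorem add {x y z : ℕ} (h : σ.reg y + σ.reg z ≤ W) :
    Reaches W (.add x y z) σ 1 (σ.setReg x (σ.reg y + σ.reg z)) :=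
  ⟨1, le_rfl, .add σ x y z h⟩

theorem load {x y : ℕ} : Reaches W (.load x y) σ 1 (σ.setReg x (σ.mem (σ.reg y))) :=
  ⟨1, le_rfl, .load σ x y⟩

theorem store {x y : ℕ} : Reaches W (.store x y) σ 1 (σ.setMem (σ.reg x) (σ.reg y)) :=
  ⟨1, le_rfl, .store σ x y⟩

end Reaches

namespace Store

@[simp] theorem setReg_mem (σ : Store) (x v : ℕ) : (σ.setReg x v).mem = σ.mem := rfl

@[simp] theorem setReg_reg (σ : Store) (x v y : ℕ) :
    (σ.setReg x v).reg y = if y = x then v else σ.reg y := by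
  simp [setReg, Function.update_apply]

@[simp] theorem setMem_reg (σ : Store) (i v : ℕ) : (σ.setMem i v).reg = σ.reg := rfl

@[simp] theorem setReg_setReg (σ : Store) (x v w : ℕ) :
    (σ.setReg x v).setReg x w = σ.setReg x w := by
  simp [setReg]

@[simp] theorem setReg_reg_self (σ : Store) (x : ℕ) : σ.setReg x (σ.reg x) = σ := by
  simp [setReg]

end Store

/-- A loop whose body advances the counter in register `2` up to the bound in register `1`. -/
theorem exists_reaches_whileLt {W n T : ℕ} {P : Program} (Inv : ℕ → Store → Prop)
    (hreg : ∀ k σ, Inv k σ → σ.reg 2 = k ∧ σ.reg 1 = n)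
    (hstep : ∀ k < n, ∀ σ, Inv k σ → ∃ σ', Reaches W P σ T σ' ∧ Inv (k + 1) σ')
    {σ : Store} (hσ : Inv 0 σ) :
    ∃ σ', Reaches W (.whileLt 2 1 P) σ (n * (T + 1) + 1) σ' ∧ Inv n σ' := by
  suffices H : ∀ d k, k + d = n → ∀ σ, Inv k σ →
      ∃ σ', Reaches W (.whileLt 2 1 P) σ (d * (T + 1) + 1) σ' ∧ Inv n σ' from
    H n 0 (zero_add n) σ hσ
  intro d
  induction d with
  | zero =>
    rintro k rfl σ hk
    obtain ⟨h2, h1⟩ := hreg _ _ hk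
    exact ⟨σ, ⟨1, by omega, .while_false (by omega)⟩, hk⟩
  | succ d ih =>
    intro k hkd σ hk
    obtain ⟨h2, h1⟩ := hreg _ _ hk
    obtain ⟨σ₁, ⟨t₁, ht₁, he₁⟩, hk₁⟩ := hstep k (by omega) σ hk
    obtain ⟨σ₂, ⟨t₂, ht₂, he₂⟩, hk₂⟩ := ih (k + 1) (by omega) σ₁ hk₁
    exact ⟨σ₂, ⟨t₁ + t₂ + 1, by rw [add_mul]; omega, .while_true (by omega) he₁ he₂⟩, hk₂⟩

/-! ### Address computations and memory terms

Register `0` holds the answer, `1` the number `n` of states, `2` the loop counter, `3` an address,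
and `4` and `5` hold values. -/

/-- `x := x + k * y` -/
def addMul (x y : ℕ) : ℕ → Program
  | 0 => .skip
  | k + 1 => .seq (.add x x y) (addMul x y k)

/-- The factor `k` is fixed in the program, so multiplication unrolls to boundedly many additions;
`y ≠ x` keeps the summand constant. -/
theorem reaches_addMul {W x y : ℕ} (hxy : y ≠ x) (k : ℕ) {σ : Store}
    (h : σ.reg x + k * σ.reg y ≤ W) :
    Reaches W (addMul x y k) σ (k + 1) (σ.setReg x (σ.reg x + k * σ.reg y)) := by
  induction k generalizing σ with
  | zero => simpa [addMul] using Reaches.skip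
  | succ k ih =>
    rw [add_mul] at h
    have := (Reaches.add (x := x) (y := x) (z := y) (σ := σ) (W := W) (by omega)).seq
      (ih (σ := σ.setReg x (σ.reg x + σ.reg y)) (by simp [hxy]; omega))
    simp only [Store.setReg_setReg, Store.setReg_reg, if_true, if_neg hxy] at this
    rw [add_mul, one_mul, add_comm (k * _), ← add_assoc (σ.reg x)]
    exact this.mono (by omega)

/-- Put the address `c + j * n + k * x` into register `3`. -/
def address (c j k x : ℕ) : Program :=
  .seq (.const 3 c) (.seq (addMul 3 1 j) (addMul 3 x k))

theorem reaches_address {W c j k x : ℕ} (hx : x ≠ 3) {σ : Store}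
    (h : c + j * σ.reg 1 + k * σ.reg x ≤ W) :
    Reaches W (address c j k x) σ (j + k + 3)
      (σ.setReg 3 (c + j * σ.reg 1 + k * σ.reg x)) := by
  have h₁ := reaches_addMul (W := W) (x := 3) (y := 1) (by decide) j (σ := σ.setReg 3 c)
    (by simp; omega)
  have h₂ := reaches_addMul (W := W) hx k
    (σ := σ.setReg 3 (c + j * σ.reg 1)) (by simpa [hx] using h)
  simp only [Store.setReg_reg, Store.setReg_setReg, if_true, if_neg hx, if_neg (show 1 ≠ 3 by decide)]
    at h₁ h₂
  exact ((Reaches.const (by omega)).seq (h₁.seq h₂)).mono (by omega)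

/-- Terms for the values that can be looked up in the memory from the loop counter. -/
inductive MemTerm where
  /-- the loop counter -/
  | counter : MemTerm
  /-- the content of the cell with address `c + j * n + k * e` -/
  | cell (c j k : ℕ) (e : MemTerm) : MemTerm

namespace MemTerm

/-- The value of a term. -/
def eval (m : ℕ → ℕ) (n q : ℕ) : MemTerm → ℕ
  | counter => q
  | cell c j k e => m (c + j * n + k * e.eval m n q)

/-- The program that puts the value of a term into register `y`. -/
def program (y : ℕ) : MemTerm → Program
  | counter => .copy y 2
  | cell c j k e => .seq (e.program y) (.seq (address c j k y) (.load y 3))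

/-- A bound for the time, and for the addresses as multiples of `n`. -/
def cost : MemTerm → ℕ
  | counter => 1
  | cell c j k e => e.cost + (c + j + k + 4)

/-- Since values never exceed `n`, nested lookups still use addresses linear in `n`. -/
theorem eval_le {m : ℕ → ℕ} {n q : ℕ} (hm : ∀ i, m i ≤ n) (hq : q ≤ n) (e : MemTerm) :
    e.eval m n q ≤ n := by
  cases e with
  | counter => exact hq
  | cell => exact hm _

theorem exists_reaches {W n q y : ℕ} {m : ℕ → ℕ} (hn : 0 < n) (hm : ∀ i, m i ≤ n) (hq : q ≤ n)
    (hy : 3 < y) (e : MemTerm) (hW : e.cost * n ≤ W) {σ : Store} (hσm : σ.mem = m)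
    (hσn : σ.reg 1 = n) (hσq : σ.reg 2 = q) :
    ∃ σ', Reaches W (e.program y) σ e.cost σ' ∧ σ'.mem = m ∧ σ'.reg y = e.eval m n q ∧
      ∀ x, x ≠ 3 → x ≠ y → σ'.reg x = σ.reg x := by
  induction e with
  | counter =>
    exact ⟨_, Reaches.copy, by simpa, by simpa [eval], fun x _ hx => by simp [hx]⟩
  | cell c j k e ih =>
    rw [cost, add_mul] at hW
    obtain ⟨σ₁, h₁, hm₁, hv₁, hr₁⟩ := ih (by omega)
    have he := eval_le hm hq e
    have h1 : σ₁.reg 1 = n := by rw [hr₁ 1 (by omega) (by omega), hσn]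
    have hb : c + j * σ₁.reg 1 + k * σ₁.reg y ≤ W := by
      rw [h1, hv₁]
      -- The address is at most `(c + j + k) * n`; the constant `c` is absorbed into `c * n` because
      -- `n` is positive.
      nlinarith [Nat.mul_le_mul_left k he, Nat.le_mul_of_pos_right c hn]
    refine ⟨_, (h₁.seq ((reaches_address (by omega) hb).seq Reaches.load)).mono ?_, ?_, ?_, ?_⟩
    · rw [cost]; omega
    · simpa
    · simp [eval, hm₁, h1, hv₁]
    · intro x hx3 hxy
      simp [hxy, hx3, hr₁ x hx3 hxy]

end MemTerm

/-! ### Checking equations between memory terms -/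

/-- Clear register `0` unless the registers `x` and `y` are equal. -/
def checkEq (x y : ℕ) : Program :=
  .ifLt x y (.const 0 0) (.ifLt y x (.const 0 0) .skip)

theorem reaches_checkEq {W x y : ℕ} {σ : Store} :
    Reaches W (checkEq x y) σ 3
      (σ.setReg 0 (if σ.reg x = σ.reg y then σ.reg 0 else 0)) := by
  rcases lt_trichotomy (σ.reg x) (σ.reg y) with h | h | h
  · rw [if_neg h.ne]
    exact ⟨2, by omega, .ifLt_true h (.const _ _ _ (by omega))⟩
  · rw [if_pos h, Store.setReg_reg_self]
    exact ⟨3, by omega, .ifLt_false h.not_lt (.ifLt_false h.not_gt (.skip _))⟩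
  · rw [if_neg h.ne']
    exact ⟨3, by omega, .ifLt_false (by omega) (.ifLt_true h (.const _ _ _ (by omega)))⟩

/-- Clear register `0` unless all the equations hold. -/
def checkAll : List (MemTerm × MemTerm) → Program
  | [] => .skip
  | e :: l => .seq (e.1.program 4) (.seq (e.2.program 5) (.seq (checkEq 4 5) (checkAll l)))

/-- A bound for the time, and for the addresses as multiples of `n`. -/
def checkCost : List (MemTerm × MemTerm) → ℕ
  | [] => 1
  | e :: l => e.1.cost + e.2.cost + 3 + checkCost l

open Classical in
theorem exists_reaches_checkAll {W n q : ℕ} {m : ℕ → ℕ} (hn : 0 < n) (hm : ∀ i, m i ≤ n)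
    (hq : q ≤ n) (l : List (MemTerm × MemTerm)) (hW : checkCost l * n ≤ W) {σ : Store}
    (hσm : σ.mem = m) (hσn : σ.reg 1 = n) (hσq : σ.reg 2 = q) :
    ∃ σ', Reaches W (checkAll l) σ (checkCost l) σ' ∧ σ'.mem = m ∧ σ'.reg 1 = n ∧ σ'.reg 2 = q ∧
      σ'.reg 0 = if ∀ e ∈ l, e.1.eval m n q = e.2.eval m n q then σ.reg 0 else 0 := by
  induction l generalizing σ with
  | nil => exact ⟨σ, Reaches.skip, hσm, hσn, hσq, by simp⟩
  | cons e l ih =>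
    simp only [checkCost, add_mul] at hW
    obtain ⟨σ₁, h₁, hm₁, hv₁, hr₁⟩ := e.1.exists_reaches (W := W) (y := 4) hn hm hq (by omega)
      (by omega) hσm hσn hσq
    obtain ⟨σ₂, h₂, hm₂, hv₂, hr₂⟩ := e.2.exists_reaches (W := W) (y := 5) hn hm hq (by omega)
      (by omega) hm₁ (by rw [hr₁ 1 (by omega) (by omega), hσn])
      (by rw [hr₁ 2 (by omega) (by omega), hσq])
    obtain ⟨σ₃, h₃, hm₃, hn₃, hq₃, h0₃⟩ := ih (by omega)
      (σ := σ₂.setReg 0 (if σ₂.reg 4 = σ₂.reg 5 then σ₂.reg 0 else 0)) (by simpa)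
      (by simp [hr₂ 1, hr₁ 1, hσn]) (by simp [hr₂ 2, hr₁ 2, hσq])
    refine ⟨σ₃, (h₁.seq (h₂.seq (reaches_checkEq.seq h₃))).mono ?_, hm₃, hn₃, hq₃, ?_⟩
    · rw [checkCost]; omega
    · rw [h0₃, Store.setReg_reg, if_pos rfl, hr₂ 4 (by omega) (by omega), hv₁, hv₂,
        hr₂ 0 (by omega) (by omega), hr₁ 0 (by omega) (by omega)]
      by_cases h : e.1.eval m n q = e.2.eval m n q <;> simp [h]

/-- Advance the loop counter. -/
def increment : Program := .seq (.const 3 1) (.add 2 2 3)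

theorem reaches_increment {W : ℕ} {σ : Store} (h : σ.reg 2 + 1 ≤ W) :
    Reaches W increment σ 2 ((σ.setReg 3 1).setReg 2 (σ.reg 2 + 1)) := by
  have := (Reaches.const (W := W) (σ := σ) (x := 3) (c := 1) (by omega)).seq
    (Reaches.add (x := 2) (y := 2) (z := 3) (by simpa using h))
  simpa [increment] using this

/-- Clear register `0` unless all the equations hold for all values of the counter below `n`. -/
def checkLoop (l : List (MemTerm × MemTerm)) : Program :=
  .whileLt 2 1 (.seq (checkAll l) increment)

open Classical in
theorem exists_reaches_checkLoop {W n : ℕ} {m : ℕ → ℕ} (hn : 0 < n) (hm : ∀ i, m i ≤ n)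
    (l : List (MemTerm × MemTerm)) (hW : checkCost l * n ≤ W) (hnW : n ≤ W) {σ : Store}
    (hσm : σ.mem = m) (hσ0 : σ.reg 0 = 1) (hσn : σ.reg 1 = n) (hσq : σ.reg 2 = 0) :
    ∃ σ', Reaches W (checkLoop l) σ (n * (checkCost l + 3) + 1) σ' ∧
      σ'.reg 0 = if ∀ q < n, ∀ e ∈ l, e.1.eval m n q = e.2.eval m n q then 1 else 0 := by
  suffices H : _ from
    let ⟨σ', h, _, _, _, h0⟩ := exists_reaches_whileLt (W := W) (n := n) (T := checkCost l + 2)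
      (P := .seq (checkAll l) increment)
      (fun k σ => σ.reg 2 = k ∧ σ.reg 1 = n ∧ σ.mem = m ∧
        σ.reg 0 = if ∀ q < k, ∀ e ∈ l, e.1.eval m n q = e.2.eval m n q then 1 else 0)
      (fun k σ h => ⟨h.1, h.2.1⟩) H (σ := σ) ⟨hσq, hσn, hσm, by simpa⟩
    ⟨σ', h, h0⟩
  · rintro k hk σ ⟨h2, h1, hmem, h0⟩
    obtain ⟨σ₁, hr, hmem₁, h1₁, h2₁, h0₁⟩ :=
      exists_reaches_checkAll hn hm hk.le l hW hmem h1 h2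
    refine ⟨_, hr.seq (reaches_increment (by omega)), by simp [h2₁], by simpa, by simpa, ?_⟩
    simp only [Store.setReg_reg]
    rw [if_neg (by decide), if_neg (by decide), h0₁, h0, ← ite_and]
    refine if_congr ⟨fun h q hq => ?_, fun h => ⟨h k k.lt_succ_self, fun q hq => h q ?_⟩⟩ rfl rfl
    · rcases Nat.lt_succ_iff_lt_or_eq.1 hq with hq | rfl
      exacts [h.2 q hq, h.1]
    · omega

/-! ### Tabulating preimages -/

/-- Write the loop counter into the cell with address `c + j * n + e`. -/
def tabulate (c j : ℕ) (e : MemTerm) : Program :=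
  .seq (e.program 4) (.seq (address c j 1 4) (.store 3 2))

theorem exists_reaches_tabulate {W n q c j : ℕ} {m : ℕ → ℕ} (hn : 0 < n) (hm : ∀ i, m i ≤ n)
    (hq : q ≤ n) (e : MemTerm) (hW : (e.cost + (c + j + 5)) * n ≤ W) {σ : Store} (hσm : σ.mem = m)
    (hσn : σ.reg 1 = n) (hσq : σ.reg 2 = q) :
    ∃ σ', Reaches W (tabulate c j e) σ (e.cost + (c + j + 5)) σ' ∧
      σ'.mem = Function.update m (c + j * n + e.eval m n q) q ∧ ∀ x < 3, σ'.reg x = σ.reg x := by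
  rw [add_mul] at hW
  obtain ⟨σ₁, h₁, hm₁, hv₁, hr₁⟩ := e.exists_reaches (W := W) (y := 4) hn hm hq (by omega)
    (by omega) hσm hσn hσq
  have he := e.eval_le hm hq
  have h1 : σ₁.reg 1 = n := by rw [hr₁ 1 (by omega) (by omega), hσn]
  have h2 : σ₁.reg 2 = q := by rw [hr₁ 2 (by omega) (by omega), hσq]
  have hb : c + j * σ₁.reg 1 + 1 * σ₁.reg 4 ≤ W := by
    rw [h1, hv₁]
    nlinarith [Nat.le_mul_of_pos_right c hn]
  refine ⟨_, (h₁.seq ((reaches_address (by omega) hb).seq Reaches.store)).mono (by omega), ?_, ?_⟩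
  · simp [Store.setMem, hm₁, h1, h2, hv₁]
  · intro x hx
    simp [hr₁ x (by omega) (by omega), show x ≠ 3 by omega]

/-! ### The input -/

theorem getD_flatMap_of_length_eq {β : Type*} {b : ℕ} {g : β → List ℕ}
    (hg : ∀ x, (g x).length = b) {l : List β} {k a : ℕ} (ha : a < b) (hk : k < l.length) :
    (l.flatMap g).getD (a + b * k) 0 = (g l[k]).getD a 0 := by
  induction l generalizing k with
  | nil => simp at hk
  | cons x l ih =>
    rw [List.flatMap_cons]
    cases k with
    | zero => rw [List.getD_append _ _ _ _ (by simpa [hg])]; rfl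
    | succ k =>
      rw [List.getD_append_right _ _ _ _ (by rw [hg, mul_add]; omega), hg]
      rw [show a + b * (k + 1) - b = a + b * k by rw [mul_add]; omega,
        ih (by simpa using hk), List.getElem_cons_succ]

theorem add_mul_lt_mul {a b q n : ℕ} (ha : a < b) (hq : q < n) : a + b * q < b * n := by
  have := Nat.mul_le_mul_left b (Nat.succ_le_of_lt hq)
  rw [Nat.mul_succ] at this
  omega

section Input

variable {b n : ℕ} (A : DFA (Fin b) (Fin n))

theorem length_encodeDFA : (encodeDFA A).length = 2 + (b + 1) * n := by
  simp [encodeDFA]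
  ring

theorem inputStore_mem_zero : (inputStore A).mem 0 = n := by
  simp [inputStore, encodeDFA]

theorem inputStore_mem_step {a q : ℕ} (ha : a < b) (hq : q < n) :
    (inputStore A).mem (2 + a + b * q) = A.step ⟨q, hq⟩ ⟨a, ha⟩ := by
  have hlt := add_mul_lt_mul ha hq
  simp only [inputStore, encodeDFA]
  rw [List.getD_append _ _ _ _ (by simp [mul_comm n]; omega),
    List.getD_append_right _ _ _ _ (by simp; omega),
    show 2 + a + b * q - [n, (A.start : ℕ)].length = a + b * q by simp; omega,
    getD_flatMap_of_length_eq (by simp) ha (by simpa)]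
  simp [ha]

open Classical in
theorem inputStore_mem_accept {q : ℕ} (hq : q < n) :
    (inputStore A).mem (2 + b * n + q) = if ⟨q, hq⟩ ∈ A.accept then 1 else 0 := by
  simp only [inputStore, encodeDFA]
  rw [List.getD_append_right _ _ _ _ (by simp [mul_comm n]; omega)]
  simp [mul_comm n, hq, show 2 + b * n + q - (b * n + 1 + 1) = q by omega]

theorem inputStore_mem_of_le {i : ℕ} (hi : 2 + (b + 1) * n ≤ i) : (inputStore A).mem i = 0 :=
  List.getD_eq_default _ _ (by rwa [length_encodeDFA])

theorem inputStore_mem_le (i : ℕ) : (inputStore A).mem i ≤ n := by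
  have hn : 0 < n := A.start.pos
  have key : ∀ x ∈ encodeDFA A, x ≤ n := by
    intro x hx
    simp only [encodeDFA, List.mem_append, List.mem_cons, List.mem_flatMap, List.mem_map,
      List.not_mem_nil, or_false] at hx
    rcases hx with ((rfl | rfl) | ⟨q, -, a, -, rfl⟩) | ⟨q, -, rfl⟩
    · rfl
    · exact A.start.is_le'
    · exact Fin.is_le'
    · split_ifs <;> omega
  rcases lt_or_ge i (encodeDFA A).length with h | h
  · simp only [inputStore]
    rw [List.getD_eq_getElem _ _ h]
    exact key _ (List.getElem_mem h)
  · simp only [inputStore]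
    rw [List.getD_eq_default _ _ h]
    exact n.zero_le

end Input

/-! ### The decision procedure -/

namespace MemTerm

/-- The successor of the state `e` by the digit `a`. -/
def digit (b a : ℕ) (e : MemTerm) : MemTerm := cell (2 + a) 0 b e

/-- The entry for the state `e` in the table starting at `2 + j * n`. -/
def entry (j : ℕ) (e : MemTerm) : MemTerm := cell 2 j 1 e

/-- The successor of the state `e` by the digit `1` followed by the inverse of the digit `0`. -/
def carry (b : ℕ) (e : MemTerm) : MemTerm := entry (b + 1) (digit b 1 e)

end MemTerm

open MemTerm in
/-- The equations that hold at all states of an automaton exactly if it is locally Pascal. -/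
def pascalEquations (b : ℕ) : List (MemTerm × MemTerm) :=
  (entry (b + 1) (digit b 0 counter), counter) ::
  (entry (b + 2) (digit b 1 counter), counter) ::
  (carry b (digit b 0 counter), digit b (b - 1) (carry b counter)) ::
  (entry b (digit b 0 counter), entry b counter) ::
  (List.range (b - 1)).map fun a => (digit b (a + 1) counter, digit b a (carry b counter))

/-- Tabulate preimages for the digits `0` and `1`, for one value of the counter. -/
def preimageStep (b : ℕ) : Program :=
  .seq (tabulate 2 (b + 1) (.digit b 0 .counter))
    (.seq (tabulate 2 (b + 2) (.digit b 1 .counter)) increment)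

/-- A bound for the time, and for the addresses as multiples of `n`. -/
def preimageCost (b : ℕ) : ℕ :=
  (MemTerm.digit b 0 .counter).cost + (2 + (b + 1) + 5) +
    ((MemTerm.digit b 1 .counter).cost + (2 + (b + 2) + 5) + 2)

/-- The decision procedure for quotients of Pascal automata. -/
def pascalProgram (b : ℕ) : Program :=
  .seq (.load 1 0) (.seq (.const 0 1) (.seq (.whileLt 2 1 (preimageStep b))
    (.seq (.const 2 0) (checkLoop (pascalEquations b)))))

/-- The input memory `m₀` has been extended to `m` by the preimages below `k` of the states under
the digits `0` and `1`. -/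
structure IsPreimageTable (b n k : ℕ) (m₀ m : ℕ → ℕ) : Prop where
  le : ∀ i, m i ≤ n
  input : ∀ i < 2 + (b + 1) * n, m i = m₀ i
  lt : ∀ y < n, m (2 + (b + 1) * n + y) < n
  preimage_zero : Set.InjOn (fun q => m₀ (2 + 0 + b * q)) (Set.Iio n) →
    ∀ q < k, m (2 + (b + 1) * n + m₀ (2 + 0 + b * q)) = q
  preimage_one : Set.InjOn (fun q => m₀ (2 + 1 + b * q)) (Set.Iio n) →
    ∀ q < k, m (2 + (b + 2) * n + m₀ (2 + 1 + b * q)) = q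

/-- The writes go past the input, into two disjoint blocks: successors under `0` are below `n`, so
the first write stays in its block. If a digit is injective, no later write destroys one of its
earlier entries. -/
theorem IsPreimageTable.succ {b n k : ℕ} {m₀ m : ℕ → ℕ} (h : IsPreimageTable b n k m₀ m)
    (hk : k < n) (h0 : ∀ q < n, m₀ (2 + 0 + b * q) < n) :
    IsPreimageTable b n (k + 1) m₀ (Function.update
      (Function.update m (2 + (b + 1) * n + m₀ (2 + 0 + b * k)) k)
      (2 + (b + 2) * n + m₀ (2 + 1 + b * k)) k) := by
  have hbn : (b + 2) * n = (b + 1) * n + n := by ring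
  have hk0 := h0 k hk
  constructor
  · intro i
    have := h.le i
    simp only [Function.update_apply]
    split_ifs <;> omega
  · intro i hi
    rw [Function.update_of_ne (by omega), Function.update_of_ne (by omega), h.input i hi]
  · intro y hy
    have := h.lt y hy
    simp only [Function.update_apply]
    split_ifs <;> omega
  · intro hinj q hq
    have hq0 := h0 q (by omega)
    rw [Function.update_of_ne (by omega), Function.update_apply]
    split_ifs with he
    · exact hinj hk (show q < n by omega) (by simp only; omega)
    · refine h.preimage_zero hinj q ?_
      have : q ≠ k := by rintro rfl; exact he rfl
      omega
  · intro hinj q hq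
    rw [Function.update_apply]
    split_ifs with he
    · exact hinj hk (show q < n by omega) (by simp only; omega)
    · rcases eq_or_ne q k with rfl | hqk
      · exact absurd rfl he
      · rw [Function.update_of_ne (by omega), h.preimage_one hinj q (by omega)]

theorem exists_reaches_preimageLoop {W b n : ℕ} {m₀ : ℕ → ℕ} (hn : 0 < n) (hb : 2 ≤ b)
    (hm₀ : ∀ i, m₀ i ≤ n) (h0 : ∀ q < n, m₀ (2 + 0 + b * q) < n)
    (hend : ∀ i, 2 + (b + 1) * n ≤ i → m₀ i = 0) (hW : preimageCost b * n ≤ W)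
    {σ : Store} (hσm : σ.mem = m₀) (hσ0 : σ.reg 0 = 1) (hσn : σ.reg 1 = n) (hσq : σ.reg 2 = 0) :
    ∃ σ', Reaches W (.whileLt 2 1 (preimageStep b)) σ (n * (preimageCost b + 1) + 1) σ' ∧
      σ'.reg 0 = 1 ∧ σ'.reg 1 = n ∧ IsPreimageTable b n n m₀ σ'.mem := by
  suffices H : _ from
    let ⟨σ', h, h'⟩ := exists_reaches_whileLt (W := W) (n := n) (T := preimageCost b)
      (P := preimageStep b)
      (fun k σ => σ.reg 2 = k ∧ σ.reg 0 = 1 ∧ σ.reg 1 = n ∧ IsPreimageTable b n k m₀ σ.mem)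
      (fun k σ h => ⟨h.1, h.2.2.1⟩) H (σ := σ) ⟨hσq, hσ0, hσn, by
        subst hσm
        -- Cells beyond the input start at `0 < n`, so even unfilled entries of the first table name
        -- states.
        exact ⟨hm₀, fun _ _ => rfl, fun y _ => by rwa [hend _ (by omega)], by simp, by simp⟩⟩
    ⟨σ', h, h'.2⟩
  rintro k hk σ ⟨h2, h0', h1, ht⟩
  have hin : ∀ a < b, ∀ m : ℕ → ℕ, (∀ i < 2 + (b + 1) * n, m i = m₀ i) →
      (MemTerm.digit b a .counter).eval m n k = m₀ (2 + a + b * k) := by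
    intro a ha m hm
    have := add_mul_lt_mul ha hk
    simp only [MemTerm.digit, MemTerm.eval, zero_mul, add_zero]
    exact hm _ (by rw [add_mul]; omega)
  rw [preimageCost, add_mul, add_mul _ 2] at hW
  have hk0 := h0 k hk
  obtain ⟨σ₁, hr₁, hm₁, hreg₁⟩ := exists_reaches_tabulate (W := W) (c := 2) (j := b + 1) hn ht.le
    hk.le (.digit b 0 .counter) (by omega) rfl h1 h2
  rw [hin 0 (by omega) _ ht.input] at hm₁
  have hin₁ : ∀ i < 2 + (b + 1) * n, σ₁.mem i = m₀ i := fun i hi => by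
    rw [hm₁, Function.update_of_ne (by omega), ht.input i hi]
  have hle₁ : ∀ i, σ₁.mem i ≤ n := fun i => by
    have := ht.le i
    rw [hm₁, Function.update_apply]
    split_ifs <;> omega
  obtain ⟨σ₂, hr₂, hm₂, hreg₂⟩ := exists_reaches_tabulate (W := W) (c := 2) (j := b + 2) hn hle₁
    hk.le (.digit b 1 .counter) (by omega) rfl (by rw [hreg₁ 1 (by omega), h1])
    (by rw [hreg₁ 2 (by omega), h2])
  rw [hin 1 (by omega) _ hin₁, hm₁] at hm₂
  have hq₂ : σ₂.reg 2 = k := by rw [hreg₂ 2 (by omega), hreg₁ 2 (by omega), h2]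
  refine ⟨_, hr₁.seq (hr₂.seq (reaches_increment (by omega))), by simp [hq₂],
    by simp [hreg₂, hreg₁, h0'], by simp [hreg₂, hreg₁, h1], ?_⟩
  simpa [hm₂] using ht.succ hk h0

/-- The first two equations say that the tables are left inverses of the digits `0` and `1`, which
certifies injectivity; the others are the remaining relations of `LocallyPascal` for the `G` read
off the first table. -/
theorem forall_pascalEquations_iff {b n : ℕ} (hb : 2 ≤ b) {A : DFA (Fin b) (Fin n)}
    (hA : IsMinimalDFA A) {m : ℕ → ℕ} (h : IsPreimageTable b n n (inputStore A).mem m) :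
    (∀ q < n, ∀ e ∈ pascalEquations b, e.1.eval m n q = e.2.eval m n q) ↔ IsPascalQuotient A := by
  classical
  have hstep : ∀ a (ha : a < b) q (hq : q < n),
      m (2 + a + b * q) = A.step ⟨q, hq⟩ ⟨a, ha⟩ := by
    intro a ha q hq
    have := add_mul_lt_mul ha hq
    rw [h.input _ (by rw [add_mul]; omega), inputStore_mem_step]
  have hacc : ∀ q (hq : q < n), m (2 + b * n + q) = if ⟨q, hq⟩ ∈ A.accept then 1 else 0 := by
    intro q hq
    rw [h.input _ (by rw [add_mul]; omega), inputStore_mem_accept A hq]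
  -- This is a map into the states even when the digit `0` is not injective and the table is
  -- meaningless.
  let G : Fin n → Fin n := fun q =>
    ⟨m (2 + (b + 1) * n + (A.step q ⟨1, by omega⟩ : ℕ)), h.lt _ (Fin.is_lt _)⟩
  have hG : ∀ q, m (2 + (b + 1) * n + (A.step q ⟨1, by omega⟩ : ℕ)) = G q := fun q => rfl
  have hinv : ∀ a (ha : a < b) j,
      (Set.InjOn (fun q => (inputStore A).mem (2 + a + b * q)) (Set.Iio n) →
        ∀ q < n, m (2 + j * n + (inputStore A).mem (2 + a + b * q)) = q) →
      Function.Injective (fun q => A.step q ⟨a, ha⟩) →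
      ∀ q, m (2 + j * n + (A.step q ⟨a, ha⟩ : ℕ)) = q := by
    intro a ha j hj hinj q
    rw [← hj ?_ q q.2, inputStore_mem_step A ha q.2]
    intro x hx y hy hxy
    simp only [inputStore_mem_step A ha hx, inputStore_mem_step A ha hy] at hxy
    exact congrArg Fin.val (hinj (Fin.ext hxy))
  have key : (∀ q < n, ∀ e ∈ pascalEquations b, e.1.eval m n q = e.2.eval m n q) ↔
      ∀ q : Fin n, m (2 + (b + 1) * n + (A.step q ⟨0, by omega⟩ : ℕ)) = q ∧
        m (2 + (b + 2) * n + (A.step q ⟨1, by omega⟩ : ℕ)) = q ∧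
        G (A.step q ⟨0, by omega⟩) = A.step (G q) ⟨b - 1, by omega⟩ ∧
        (A.step q ⟨0, by omega⟩ ∈ A.accept ↔ q ∈ A.accept) ∧
        ∀ a (ha : a + 1 < b), A.step q ⟨a + 1, ha⟩ = A.step (G q) ⟨a, by omega⟩ := by
    rw [Fin.forall_iff]
    refine forall₂_congr fun q hq => ?_
    simp only [pascalEquations, List.forall_mem_cons, List.forall_mem_map, List.mem_range,
      MemTerm.entry, MemTerm.digit, MemTerm.carry, MemTerm.eval, zero_mul, add_zero, one_mul]
    rw [hstep 0 (by omega) q hq, hstep 1 (by omega) q hq, hstep 1 (by omega) _ (Fin.is_lt _),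
      hG, hG, hstep (b - 1) (by omega) _ (Fin.is_lt _), hacc _ (Fin.is_lt _), hacc _ hq]
    refine and_congr_right' (and_congr_right' (and_congr Fin.ext_iff.symm (and_congr ?_ ?_)))
    · by_cases h₁ : A.step ⟨q, hq⟩ ⟨0, by omega⟩ ∈ A.accept <;>
        by_cases h₂ : (⟨q, hq⟩ : Fin n) ∈ A.accept <;> simp [h₁, h₂]
    · refine forall_congr' fun a => ⟨fun H ha => ?_, fun H ha => ?_⟩
      · have := H (by omega)
        rwa [hstep _ ha q hq, hstep a (by omega) _ (Fin.is_lt _), ← Fin.ext_iff] at this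
      · rw [hstep _ (by omega) q hq, hstep a (by omega) _ (Fin.is_lt _), ← Fin.ext_iff]
        exact H (by omega)
  rw [key]
  constructor
  · intro H
    refine LocallyPascal.isPascalQuotient (hb := hb) (G := G)
      ⟨fun x y hxy => ?_, fun x y hxy => ?_, fun q => (H q).2.2.2.2, fun q => (H q).2.2.1,
        fun q => (H q).2.2.2.1⟩ hA
    · simp only at hxy
      rw [Fin.ext_iff, ← (H x).1, ← (H y).1, hxy]
    · simp only at hxy
      rw [Fin.ext_iff, ← (H x).2.1, ← (H y).2.1, hxy]
  · intro H
    have hL : LocallyPascal hb A G := by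
      refine H.locallyPascal hb fun hinj q => ?_
      -- An injective digit `0` is onto, so `q·1 = x·0` for some `x`, and the table entry at `x·0`
      -- is `x`.
      obtain ⟨x, hx⟩ := Finite.surjective_of_injective hinj (A.step q ⟨1, by omega⟩)
      have : G q = x := Fin.ext <| by
        rw [← hG, ← hx]
        exact hinv 0 _ _ h.preimage_zero hinj x
      rw [this]
      exact hx
    exact fun q => ⟨hinv 0 _ _ h.preimage_zero hL.injective_zero q,
      hinv 1 _ _ h.preimage_one hL.injective_one q, hL.step_zero q, hL.accept_iff q,
      hL.step_succ q⟩

/-- For every base `b`, one program decides in linear time, on words of logarithmic length, whether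
a minimal DFA over the digits of base `b` is a quotient of a Pascal automaton. The answer is left in
register `0`. -/
theorem mainTheorem5 (b : ℕ) (hb : 2 ≤ b) :
    ∃ (P : Program) (C : ℕ), ∀ (n : ℕ) (A : DFA (Fin b) (Fin n)), IsMinimalDFA A →
      ∃ (t : ℕ) (σ : Store), t ≤ C * n ∧ Exec (C * n) P (inputStore A) t σ ∧
        (IsPascalQuotient A → σ.reg 0 = 1) ∧ (¬ IsPascalQuotient A → σ.reg 0 = 0) := by
  classical
  -- Beyond the two costs, the loops spend `1 + 3` further steps per state, and `5` steps occur
  -- once; as `n ≥ 1`, these add at most `9 * n`.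
  refine ⟨pascalProgram b, preimageCost b + checkCost (pascalEquations b) + 9, fun n A hA => ?_⟩
  have hn : 0 < n := A.start.pos
  set W := (preimageCost b + checkCost (pascalEquations b) + 9) * n with hW
  have hW' : W = preimageCost b * n + checkCost (pascalEquations b) * n + 9 * n := by
    rw [hW]; ring
  obtain ⟨σ₁, hr₁, h0₁, h1₁, ht⟩ := exists_reaches_preimageLoop (W := W) hn hb
    (inputStore_mem_le A)
    (fun q hq => by rw [inputStore_mem_step A (by omega) hq]; exact Fin.is_lt _)
    (fun i => inputStore_mem_of_le A) (by omega) (σ := ((inputStore A).setReg 1 n).setReg 0 1)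
    rfl (by simp) (by simp) (by simp [inputStore])
  obtain ⟨σ₂, hr₂, h0₂⟩ := exists_reaches_checkLoop (W := W) hn ht.le (pascalEquations b)
    (by omega) (by omega) (σ := σ₁.setReg 2 0) rfl (by simpa) (by simpa) (by simp)
  rw [if_congr (forall_pascalEquations_iff hb hA ht) rfl rfl] at h0₂
  have hload : Reaches W (.load 1 0) (inputStore A) 1 ((inputStore A).setReg 1 n) := by
    have := Reaches.load (W := W) (σ := inputStore A) (x := 1) (y := 0)
    rwa [show (inputStore A).reg 0 = 0 from rfl, inputStore_mem_zero] at this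
  obtain ⟨t, ht, he⟩ := hload.seq ((Reaches.const (by omega)).seq
    (hr₁.seq ((Reaches.const (by omega)).seq hr₂)))
  refine ⟨t, σ₂, ht.trans ?_, he, fun h => by rw [h0₂, if_pos h], fun h => by rw [h0₂, if_neg h]⟩
  rw [hW']
  nlinarith
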